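/- Let $V$ be a valuation domain with quotient field $K$, and let $F(V)$ be the set of nonzero fractional ideals of $V$. For $I\in F(V)$ put $$\hat I=\{x\in K : xI^{n}\subseteq I^{n+1}\text{ for some integer } n\ge 1\}$$ (the generalized Ratliff–Rush closure of $I$, which is again a nonzero fractional ideal of $V$) and $I_v=(I^{-1})^{-1}$, where $I^{-1}=\{x\in K : xI\subseteq V\}$. A map $*:F(V)\to F(V)$, $E\mapsto E^*$, is called a star operation on $V$ if for all $E,F\in F(V)$ and all $0\ne a\in K$: $V^*=V$ and $(aE)^*=aE^*$; $E\subseteq E^*$, and $E\subseteq F$ implies $E^*\subseteq F^*$; and $(E^*)^*=E^*$. The map $I\mapsto\hat I$ is a star operation on $V$ if and only if no nonzero nonmaximal prime ideal $P$ of $V$ is idempotent (that is, $P^2\neq P$ for every such $P$). In this case $\hat I=I_v$ for every $I\in F(V)$. -/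

import Mathlib

open scoped nonZeroDivisors

section RatliffRush

theorem ratliffRush_mono_exponent {R K : Type*} [CommRing R] [Field K] [Algebra R K]
    [IsFractionRing R K] (I : FractionalIdeal R⁰ K) {x : K} {n m : ℕ} (hnm : n ≤ m)
    (h : ∀ y ∈ I ^ n, x * y ∈ I ^ (n + 1)) : ∀ y ∈ I ^ m, x * y ∈ I ^ (m + 1) := by
  rw [← FractionalIdeal.spanSingleton_mul_le_iff] at h ⊢
  obtain ⟨k, rfl⟩ := Nat.exists_eq_add_of_le hnm
  have h2 := mul_le_mul_left h (I ^ k)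
  calc FractionalIdeal.spanSingleton R⁰ x * I ^ (n + k)
      = FractionalIdeal.spanSingleton R⁰ x * I ^ n * I ^ k := by ring
    _ ≤ I ^ (n + 1) * I ^ k := h2
    _ = I ^ (n + k + 1) := by ring

variable (R : Type*) [CommRing R] [IsDomain R]
variable (K : Type*) [Field K] [Algebra R K] [IsFractionRing R K]

/-- `F(R)`: the nonzero fractional ideals of the domain `R` with quotient field `K`. -/
abbrev NonzeroFracIdeal : Type _ :=
  {E : FractionalIdeal R⁰ K // E ≠ 0}

variable {R K}

namespace NonzeroFracIdeal

/-- The ring `R` itself, as a nonzero fractional ideal. -/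
noncomputable def unit (R : Type*) [CommRing R] [IsDomain R]
    (K : Type*) [Field K] [Algebra R K] [IsFractionRing R K] : NonzeroFracIdeal R K :=
  ⟨1, one_ne_zero⟩

/-- The nonzero fractional ideal `aE`, for `0 ≠ a ∈ K`. -/
noncomputable def scale (a : K) (ha : a ≠ 0) (E : NonzeroFracIdeal R K) :
    NonzeroFracIdeal R K :=
  ⟨FractionalIdeal.spanSingleton R⁰ a * E.1,
    by
      intro h
      apply E.2
      rw [FractionalIdeal.eq_zero_iff] at h ⊢
      intro y hy
      have hy' := h (a * y)
        (FractionalIdeal.mul_mem_mul (FractionalIdeal.mem_spanSingleton_self R⁰ a) hy)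
      exact (mul_eq_zero.mp hy').resolve_left ha⟩

end NonzeroFracIdeal

/-- A star operation on `R` is a map `* : F(R) → F(R)` such that `R* = R`, `(aE)* = aE*`,
`E ⊆ E*`, `E ⊆ F` implies `E* ⊆ F*`, and `E** = E*`,
for all `E, F ∈ F(R)` and `0 ≠ a ∈ K`. -/
structure IsStarOperation (star : NonzeroFracIdeal R K → NonzeroFracIdeal R K) : Prop where
  map_unit : star (NonzeroFracIdeal.unit R K) = NonzeroFracIdeal.unit R K
  map_scale : ∀ (a : K) (ha : a ≠ 0) (E : NonzeroFracIdeal R K),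
    star (E.scale a ha) = (star E).scale a ha
  le_star : ∀ E : NonzeroFracIdeal R K, E ≤ star E
  mono : ∀ E F : NonzeroFracIdeal R K, E ≤ F → star E ≤ star F
  idem : ∀ E : NonzeroFracIdeal R K, star (star E) = star E

/-- The generalized Ratliff–Rush closure `{x ∈ K | x Iⁿ ⊆ Iⁿ⁺¹ for some n ≥ 1}` of a nonzero
fractional ideal `I` of an arbitrary domain; it is an `R`-submodule of `K`. -/
def ratliffRushSubmodule (I : NonzeroFracIdeal R K) : Submodule R K where
  carrier := {x : K | ∃ n : ℕ, 1 ≤ n ∧ ∀ y ∈ I.1 ^ n, x * y ∈ I.1 ^ (n + 1)}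
  zero_mem' := ⟨1, le_rfl, fun y _ => by rw [zero_mul]; exact (I.1 ^ (1 + 1)).zero_mem⟩
  add_mem' := by
    rintro a b ⟨n, hn, ha⟩ ⟨m, _, hb⟩
    refine ⟨max n m, hn.trans (le_max_left _ _), fun y hy => ?_⟩
    rw [add_mul]
    exact Submodule.add_mem (I.1 ^ (max n m + 1) : FractionalIdeal R⁰ K).coeToSubmodule
      (ratliffRush_mono_exponent I.1 (le_max_left n m) ha y hy)
      (ratliffRush_mono_exponent I.1 (le_max_right n m) hb y hy)
  smul_mem' := by
    rintro c x ⟨n, hn, hx⟩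
    refine ⟨n, hn, fun y hy => ?_⟩
    rw [smul_mul_assoc]
    exact Submodule.smul_mem (I.1 ^ (n + 1) : FractionalIdeal R⁰ K).coeToSubmodule c (hx y hy)

theorem le_ratliffRushSubmodule (I : NonzeroFracIdeal R K) :
    (I.1 : Submodule R K) ≤ ratliffRushSubmodule I := by
  intro x hx
  refine ⟨1, le_rfl, fun y hy => ?_⟩
  rw [pow_one] at hy
  rw [pow_succ, pow_one]
  exact FractionalIdeal.mul_mem_mul hx hy

/-- Over an integrally closed domain, such as a valuation domain, the generalized Ratliff–Rush
closure of a nonzero fractional ideal is again a fractional ideal. -/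
theorem isFractional_ratliffRushSubmodule [IsIntegrallyClosed R] (I : NonzeroFracIdeal R K) :
    IsFractional R⁰ (ratliffRushSubmodule I) := by
  obtain ⟨d, hd, hdI⟩ := I.1.isFractional
  obtain ⟨c, hc0, hc⟩ := FractionalIdeal.exists_ne_zero_mem_isInteger I.2
  refine ⟨d ^ 2 * c, mul_mem (pow_mem hd 2) (mem_nonZeroDivisors_of_ne_zero hc0), ?_⟩
  rintro x ⟨n, hn, hx⟩
  have h1 : FractionalIdeal.spanSingleton R⁰ (algebraMap R K d) * I.1 ≤ 1 := by
    rw [FractionalIdeal.spanSingleton_mul_le_iff]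
    intro y hy
    obtain ⟨r, hr⟩ := hdI y hy
    rw [Algebra.smul_def] at hr
    exact (FractionalIdeal.mem_one_iff R⁰).mpr ⟨r, hr⟩
  have h2 : ∀ m : ℕ, ∀ y ∈ I.1 ^ m, (algebraMap R K d) ^ m * y ∈ (1 : FractionalIdeal R⁰ K) := by
    intro m
    rw [← FractionalIdeal.spanSingleton_mul_le_iff, ← FractionalIdeal.spanSingleton_pow,
      ← mul_pow]
    exact pow_le_one' h1 m
  have h0 : ∀ m : ℕ, (algebraMap R K c) ^ m ∈ I.1 ^ m := by
    intro m
    induction m with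
    | zero => rw [pow_zero, pow_zero]; exact FractionalIdeal.one_mem_one R⁰
    | succ m ih => rw [pow_succ, pow_succ]; exact FractionalIdeal.mul_mem_mul ih hc
  have h3 : ∀ k : ℕ, x ^ k * (algebraMap R K c) ^ n ∈ I.1 ^ (n + k) := by
    intro k
    induction k with
    | zero => simpa using h0 n
    | succ k ih =>
      have h := ratliffRush_mono_exponent I.1 (Nat.le_add_right n k) hx _ ih
      rw [← mul_assoc, ← pow_succ'] at h
      exact h
  have h4 := h2 (n + n) _ (h3 n)
  obtain ⟨r, hr⟩ := (FractionalIdeal.mem_one_iff R⁰).mp h4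
  have h5 : ((d ^ 2 * c) • x) ^ n = algebraMap R K r := by
    rw [hr, Algebra.smul_def, map_mul, map_pow]
    ring
  obtain ⟨s, hs⟩ := IsIntegrallyClosed.isIntegral_iff.mp
    (IsIntegral.of_pow (Nat.pos_of_ne_zero (by omega)) (h5 ▸ isIntegral_algebraMap))
  exact ⟨s, hs⟩

/-- The generalized Ratliff–Rush closure as a fractional ideal, for `R` integrally closed. -/
def ratliffRushFracIdeal [IsIntegrallyClosed R] (I : NonzeroFracIdeal R K) :
    FractionalIdeal R⁰ K :=
  ⟨ratliffRushSubmodule I, isFractional_ratliffRushSubmodule I⟩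

/-- The generalized Ratliff–Rush closure as a map `F(R) → F(R)`, for `R` integrally closed. -/
def ratliffRushClosure [IsIntegrallyClosed R] (I : NonzeroFracIdeal R K) :
    NonzeroFracIdeal R K :=
  ⟨ratliffRushFracIdeal I, by
    intro h
    apply I.2
    rw [FractionalIdeal.eq_zero_iff] at h ⊢
    exact fun y hy => h y (le_ratliffRushSubmodule I hy)⟩

theorem inv_ne_zero_of_ne_zero {I : FractionalIdeal R⁰ K} (hI : I ≠ 0) : I⁻¹ ≠ 0 := by
  intro h
  obtain ⟨d, hd, hdI⟩ := I.isFractional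
  rw [FractionalIdeal.eq_zero_iff] at h
  have h1 : algebraMap R K d ∈ I⁻¹ := by
    rw [FractionalIdeal.mem_inv_iff hI]
    intro y hy
    obtain ⟨r, hr⟩ := hdI y hy
    rw [Algebra.smul_def] at hr
    exact (FractionalIdeal.mem_one_iff R⁰).mpr ⟨r, hr⟩
  exact IsFractionRing.to_map_ne_zero_of_mem_nonZeroDivisors hd (h _ h1)

/-- The `v`-operation `I_v = (I⁻¹)⁻¹`, where `I⁻¹ = {x ∈ K | x I ⊆ R}`, as a map
`F(R) → F(R)`. -/
noncomputable def vClosure (I : NonzeroFracIdeal R K) : NonzeroFracIdeal R K :=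
  ⟨(I.1⁻¹)⁻¹, inv_ne_zero_of_ne_zero (inv_ne_zero_of_ne_zero I.2)⟩

end RatliffRush

open scoped nonZeroDivisors

/-! ### The divisorial closure over an arbitrary domain. -/

section FractionalIdealLemmas

/-! The `v`-operation is a star operation on any domain, and over a valuation domain `I_v ⊆ Î`
always, so the converse inclusion is the crux. If `x ∈ Î` but `x ∉ I_v`, some `z` has `zI ⊆ V` and
`w = zx ∉ V`. With `J = zI`, `wJⁿ ⊆ Jⁿ⁺¹` forces `Jⁿ` to be a nonzero nonmaximal idempotent prime
(`FractionalIdeal.exists_isPrime_mul_self_eq`). Conversely, such a prime `P` has a closure not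
contained in `V`, against monotonicity and `V* = V`. -/

theorem FractionalIdeal.mul_mem_of_mem_one {R K : Type*} [CommRing R] [Field K] [Algebra R K]
    (I : FractionalIdeal R⁰ K) {c y : K}
    (hc : c ∈ (1 : FractionalIdeal R⁰ K)) (hy : y ∈ I) : c * y ∈ I := by
  have h := FractionalIdeal.mul_mem_mul hc hy
  rwa [one_mul] at h

theorem FractionalIdeal.pow_ne_zero_of_ne_zero {R K : Type*} [CommRing R] [Field K] [Algebra R K]
    {I : FractionalIdeal R⁰ K} (hI : I ≠ 0) (n : ℕ) : I ^ n ≠ 0 := by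
  rw [Ne, FractionalIdeal.eq_zero_iff] at hI ⊢
  push Not at hI ⊢
  obtain ⟨y, hy, hy0⟩ := hI
  refine ⟨y ^ n, ?_, pow_ne_zero n hy0⟩
  induction n with
  | zero =>
    rw [pow_zero, pow_zero]
    exact FractionalIdeal.one_mem_one R⁰
  | succ n ih =>
    rw [pow_succ, pow_succ]
    exact FractionalIdeal.mul_mem_mul ih hy

variable {V K : Type*} [CommRing V] [IsDomain V] [Field K] [Algebra V K] [IsFractionRing V K]

theorem mem_vClosure_iff (I : NonzeroFracIdeal V K) (x : K) :
    x ∈ (vClosure I).1 ↔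
      ∀ z : K, (∀ y ∈ I.1, z * y ∈ (1 : FractionalIdeal V⁰ K)) →
        z * x ∈ (1 : FractionalIdeal V⁰ K) := by
  change x ∈ (I.1⁻¹)⁻¹ ↔ _
  rw [FractionalIdeal.mem_inv_iff (inv_ne_zero_of_ne_zero I.2)]
  simp only [FractionalIdeal.mem_inv_iff I.2, mul_comm x]

theorem mem_scale_iff {a : K} (ha : a ≠ 0) (I : NonzeroFracIdeal V K) (x : K) :
    x ∈ (I.scale a ha).1 ↔ a⁻¹ * x ∈ I.1 := by
  change x ∈ FractionalIdeal.spanSingleton V⁰ a * I.1 ↔ _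
  rw [FractionalIdeal.mem_singleton_mul]
  constructor
  · rintro ⟨y, hy, rfl⟩
    rwa [inv_mul_cancel_left₀ ha]
  · exact fun h => ⟨_, h, (mul_inv_cancel_left₀ ha x).symm⟩

/-- Inversion is an inclusion-reversing polarity, so its square is formally a closure operation. -/
theorem isStarOperation_vClosure :
    IsStarOperation (vClosure : NonzeroFracIdeal V K → NonzeroFracIdeal V K) where
  map_unit := by
    refine Subtype.ext (FractionalIdeal.ext fun x => ?_)
    rw [mem_vClosure_iff]
    constructor
    · intro h
      have h1 := h 1 fun y hy => by rwa [one_mul]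
      rwa [one_mul] at h1
    · intro hx z hz
      have hz1 := hz 1 (FractionalIdeal.one_mem_one V⁰)
      rw [mul_one] at hz1
      exact FractionalIdeal.mul_mem_of_mem_one 1 hz1 hx
  map_scale := by
    intro a ha E
    refine Subtype.ext (FractionalIdeal.ext fun x => ?_)
    rw [mem_scale_iff, mem_vClosure_iff, mem_vClosure_iff]
    constructor
    · intro h z hz
      rw [← mul_assoc]
      refine h (z * a⁻¹) fun y hy => ?_
      rw [mul_assoc]
      exact hz _ ((mem_scale_iff ha E y).mp hy)
    · intro h z hz
      have h1 := h (z * a) fun y hy => by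
        rw [mul_assoc]
        refine hz _ ((mem_scale_iff ha E _).mpr ?_)
        rwa [inv_mul_cancel_left₀ ha]
      rwa [mul_assoc, mul_inv_cancel_left₀ ha] at h1
  le_star := fun E x hx => (mem_vClosure_iff E x).mpr fun _ hz => hz x hx
  mono := fun E F hEF x hx => (mem_vClosure_iff F x).mpr fun z hz =>
    (mem_vClosure_iff E x).mp hx z fun y hy => hz y (hEF hy)
  idem := by
    intro E
    refine Subtype.ext (FractionalIdeal.ext fun x => ?_)
    rw [mem_vClosure_iff, mem_vClosure_iff]
    exact ⟨fun h z hz => h z fun y hy => (mem_vClosure_iff E y).mp hy z hz,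
      fun h z hz => hz x ((mem_vClosure_iff E x).mpr h)⟩

end FractionalIdealLemmas

/-! ### Comparison of the two closures over a valuation ring. -/

section Valuation

variable {V K : Type*} [CommRing V] [IsDomain V] [ValuationRing V]
  [Field K] [Algebra V K] [IsFractionRing V K]

theorem mem_one_or_inv_mem_one (V : Type*) [CommRing V] [IsDomain V] [ValuationRing V]
    {K : Type*} [Field K] [Algebra V K] [IsFractionRing V K] (x : K) :
    x ∈ (1 : FractionalIdeal V⁰ K) ∨ x⁻¹ ∈ (1 : FractionalIdeal V⁰ K) := by
  simp only [FractionalIdeal.mem_one_iff]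
  exact ValuationRing.isInteger_or_isInteger V x

/-- In a valuation ring, an element outside a fractional ideal divides every element of it. -/
theorem FractionalIdeal.inv_mul_mem_one_of_notMem {I : FractionalIdeal V⁰ K} {x y : K}
    (hx : x ∉ I) (hy : y ∈ I) : x⁻¹ * y ∈ (1 : FractionalIdeal V⁰ K) := by
  by_contra h
  have h1 := (mem_one_or_inv_mem_one V (x⁻¹ * y)).resolve_left h
  have hy0 : y ≠ 0 := by
    rintro rfl
    exact h (by rw [mul_zero]; exact FractionalIdeal.zero_mem _)
  have h2 := FractionalIdeal.mul_mem_of_mem_one I h1 hy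
  rw [mul_inv, inv_inv, inv_mul_cancel_right₀ hy0] at h2
  exact hx h2

/-- A proper idempotent ideal of a valuation ring is prime. -/
theorem Ideal.isPrime_of_mul_self_eq {P : Ideal V} (hP : P ≠ ⊤) (h : P * P = P) : P.IsPrime := by
  refine ⟨hP, fun {a b} hab => or_iff_not_imp_left.mpr fun ha => ?_⟩
  have ha0 : a ≠ 0 := fun h0 => ha (h0 ▸ P.zero_mem)
  have hle : P ≤ Ideal.span {a} := by
    intro y hy
    rw [Ideal.mem_span_singleton]
    exact (ValuationRing.dvd_total a y).resolve_right fun hd => ha (P.mem_of_dvd hd hy)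
  have hab' : a * b ∈ Ideal.span {a} * P := by
    rw [← h] at hab
    exact Ideal.mul_mono_left hle hab
  obtain ⟨c, hc, hcb⟩ := Ideal.mem_span_singleton_mul.mp hab'
  rwa [← mul_left_cancel₀ ha0 hcb]

theorem vClosure_le_ratliffRushClosure (I : NonzeroFracIdeal V K) :
    vClosure I ≤ ratliffRushClosure I := by
  intro x hxv
  have hx := (mem_vClosure_iff I x).mp hxv
  by_cases hxI : x ∈ I.1
  · exact le_ratliffRushSubmodule I hxI
  have hx0 : x ≠ 0 := fun h0 => hxI (h0 ▸ I.1.zero_mem)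
  -- The exponent 1 suffices: `xy` factors as `(xy/t) · t` with both factors in `I`.
  refine ⟨1, le_rfl, fun y hy => ?_⟩
  rw [pow_one] at hy
  rcases eq_or_ne y 0 with rfl | hy0
  · rw [mul_zero]
    exact FractionalIdeal.zero_mem _
  -- Otherwise `I = yV` is principal, hence divisorial, and `x ∈ I`.
  obtain ⟨t, ht, hty⟩ : ∃ t ∈ I.1, y⁻¹ * t ∉ (1 : FractionalIdeal V⁰ K) := by
    by_contra! hall
    have h := FractionalIdeal.mul_mem_of_mem_one I.1 (hx _ hall) hy
    rw [mul_right_comm, inv_mul_cancel₀ hy0, one_mul] at h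
    exact hxI h
  have ht0 : t ≠ 0 := by
    rintro rfl
    exact hty (by rw [mul_zero]; exact FractionalIdeal.zero_mem _)
  -- If not, the inverse of `xy/t` carries `I` into `V`, hence also `x`, giving `t/y ∈ V`.
  have hmem : x * (y * t⁻¹) ∈ I.1 := by
    by_contra hn
    have h := hx _ fun z hz => FractionalIdeal.inv_mul_mem_one_of_notMem hn hz
    apply hty
    convert h using 1
    field_simp
  rw [pow_succ, pow_one]
  convert FractionalIdeal.mul_mem_mul hmem ht using 1
  field_simp

theorem FractionalIdeal.exists_isPrime_mul_self_eq {J : FractionalIdeal V⁰ K} (hJ0 : J ≠ 0)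
    (hJ1 : J ≤ 1) {w : K} (hw : w ∉ (1 : FractionalIdeal V⁰ K)) {n : ℕ}
    (h : FractionalIdeal.spanSingleton V⁰ w * J ^ n ≤ J ^ (n + 1)) :
    ∃ P : Ideal V, P.IsPrime ∧ P ≠ ⊥ ∧ ¬ P.IsMaximal ∧ P * P = P := by
  have hw0 : w ≠ 0 := by
    rintro rfl
    exact hw (FractionalIdeal.zero_mem _)
  have hwinv := (mem_one_or_inv_mem_one V w).resolve_left hw
  have hone : (1 : FractionalIdeal V⁰ K) ≤ FractionalIdeal.spanSingleton V⁰ w := by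
    rw [FractionalIdeal.one_le]
    obtain ⟨r, hr⟩ := (FractionalIdeal.mem_one_iff V⁰).mp hwinv
    exact (FractionalIdeal.mem_spanSingleton V⁰).mpr
      ⟨r, by rw [Algebra.smul_def, hr, inv_mul_cancel₀ hw0]⟩
  -- Since `w⁻¹ ∈ V`, `Jⁿ ⊆ wJⁿ ⊆ Jⁿ⁺¹ ⊆ Jⁿ`.
  have hsucc : J ^ (n + 1) = J ^ n := by
    refine le_antisymm ?_ (le_trans ?_ h)
    · rw [pow_succ]
      exact mul_le_of_le_one_right' hJ1
    · exact le_mul_of_one_le_left' hone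
  have hpow : ∀ k : ℕ, J ^ (n + k) = J ^ n := by
    intro k
    induction k with
    | zero => rfl
    | succ k ih => rw [← add_assoc, pow_succ, ih, ← pow_succ, hsucc]
  obtain ⟨P, hP⟩ := FractionalIdeal.le_one_iff_exists_coeIdeal.mp (pow_le_one' hJ1 n)
  have hmul : ∀ y ∈ J ^ n, w * y ∈ J ^ n := by
    rwa [hsucc, FractionalIdeal.spanSingleton_mul_le_iff] at h
  have hone_notMem : (1 : K) ∉ J ^ n := fun h1 => by
    have h2 := hmul 1 h1
    rw [mul_one] at h2
    exact hw (pow_le_one' hJ1 n h2)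
  have htop : P ≠ ⊤ := by
    rintro rfl
    rw [FractionalIdeal.coeIdeal_top] at hP
    exact hone_notMem (hP ▸ FractionalIdeal.one_mem_one V⁰)
  have hidem : P * P = P := by
    apply FractionalIdeal.coeIdeal_injective (K := K)
    change ((P * P : Ideal V) : FractionalIdeal V⁰ K) = P
    rw [FractionalIdeal.coeIdeal_mul, hP, ← pow_add, hpow]
  refine ⟨P, Ideal.isPrime_of_mul_self_eq htop hidem, ?_, fun hmax => ?_, hidem⟩
  · rintro rfl
    rw [FractionalIdeal.coeIdeal_bot] at hP
    exact FractionalIdeal.pow_ne_zero_of_ne_zero hJ0 n hP.symm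
  -- A maximal `P` would contain the nonunit `w⁻¹`, and then `1 = w · w⁻¹ ∈ Jⁿ`.
  · obtain ⟨s, hs⟩ := (FractionalIdeal.mem_one_iff V⁰).mp hwinv
    have hsP : s ∈ P := by
      rw [IsLocalRing.eq_maximalIdeal hmax, IsLocalRing.mem_maximalIdeal, mem_nonunits_iff]
      intro hu
      obtain ⟨t, ht⟩ := hu.exists_right_inv
      refine hw ((FractionalIdeal.mem_one_iff V⁰).mpr ⟨t, ?_⟩)
      have h1 := congrArg (algebraMap V K) ht
      rw [map_mul, hs, map_one] at h1
      exact ((inv_mul_eq_one₀ hw0).mp h1).symm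
    have h1 := hmul _ (hP ▸ (FractionalIdeal.mem_coeIdeal V⁰).mpr ⟨s, hsP, hs⟩)
    rw [mul_inv_cancel₀ hw0] at h1
    exact hone_notMem h1

theorem ratliffRushClosure_le_vClosure
    (hV : ∀ P : Ideal V, P.IsPrime → P ≠ ⊥ → ¬ P.IsMaximal → P * P ≠ P)
    (I : NonzeroFracIdeal V K) : ratliffRushClosure I ≤ vClosure I := by
  rintro x ⟨n, -, hx⟩
  refine (mem_vClosure_iff I x).mpr fun z hz => ?_
  by_contra hzx
  have hz0 : z ≠ 0 := by
    rintro rfl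
    exact hzx (by rw [zero_mul]; exact FractionalIdeal.zero_mem _)
  have hle : FractionalIdeal.spanSingleton V⁰ (z * x) *
      (FractionalIdeal.spanSingleton V⁰ z * I.1) ^ n ≤
        (FractionalIdeal.spanSingleton V⁰ z * I.1) ^ (n + 1) := by
    rw [← FractionalIdeal.spanSingleton_mul_le_iff] at hx
    calc _ = FractionalIdeal.spanSingleton V⁰ z ^ (n + 1) *
          (FractionalIdeal.spanSingleton V⁰ x * I.1 ^ n) := by
            rw [← FractionalIdeal.spanSingleton_mul_spanSingleton]
            ring
      _ ≤ FractionalIdeal.spanSingleton V⁰ z ^ (n + 1) * I.1 ^ (n + 1) := by gcongr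
      _ = _ := (mul_pow _ _ _).symm
  obtain ⟨P, hprime, hbot, hmax, hidem⟩ := FractionalIdeal.exists_isPrime_mul_self_eq
    (I.scale z hz0).2 (FractionalIdeal.spanSingleton_mul_le_iff.mpr hz) hzx hle
  exact hV P hprime hbot hmax hidem

theorem ratliffRushClosure_eq_vClosure
    (hV : ∀ P : Ideal V, P.IsPrime → P ≠ ⊥ → ¬ P.IsMaximal → P * P ≠ P)
    (I : NonzeroFracIdeal V K) : ratliffRushClosure I = vClosure I :=
  le_antisymm (ratliffRushClosure_le_vClosure hV I) (vClosure_le_ratliffRushClosure I)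

theorem IsStarOperation.mul_self_ne_of_not_isMaximal
    (hstar : IsStarOperation (ratliffRushClosure : NonzeroFracIdeal V K → NonzeroFracIdeal V K))
    (P : Ideal V) (hprime : P.IsPrime) (hbot : P ≠ ⊥) (hmax : ¬ P.IsMaximal) : P * P ≠ P := by
  intro hidem
  obtain ⟨s, hsM, hsP⟩ : ∃ s ∈ IsLocalRing.maximalIdeal V, s ∉ P := by
    by_contra! hle
    exact hmax (le_antisymm (IsLocalRing.le_maximalIdeal hprime.ne_top) hle ▸
      IsLocalRing.maximalIdeal.isMaximal V)
  have hs0 : algebraMap V K s ≠ 0 := by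
    rw [Ne, IsFractionRing.to_map_eq_zero_iff]
    rintro rfl
    exact hsP P.zero_mem
  let I : NonzeroFracIdeal V K := ⟨P, FractionalIdeal.coeIdeal_ne_zero.mpr hbot⟩
  -- As `s ∉ P`, it divides every element of `P`, with quotient in `P` by primality: `s⁻¹P ⊆ P =
  -- P²`.
  have hmem : (algebraMap V K s)⁻¹ ∈ (ratliffRushClosure I).1 := by
    refine ⟨1, le_rfl, fun y hy => ?_⟩
    rw [pow_one] at hy
    obtain ⟨p, hp, rfl⟩ := (FractionalIdeal.mem_coeIdeal V⁰).mp hy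
    have hI : I.1 ^ (1 + 1) = I.1 := by
      change (P : FractionalIdeal V⁰ K) ^ (1 + 1) = P
      rw [pow_succ, pow_one, ← FractionalIdeal.coeIdeal_mul, hidem]
    rw [hI]
    obtain ⟨t, rfl⟩ :=
      (ValuationRing.dvd_total s p).resolve_right fun hd => hsP (P.mem_of_dvd hd hp)
    rw [map_mul, inv_mul_cancel_left₀ hs0]
    exact (FractionalIdeal.mem_coeIdeal V⁰).mpr
      ⟨t, (hprime.mem_or_mem hp).resolve_left hsP, rfl⟩
  have hle : ratliffRushClosure I ≤ NonzeroFracIdeal.unit V K := by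
    rw [← hstar.map_unit]
    exact hstar.mono _ _ (show (P : FractionalIdeal V⁰ K) ≤ 1 from FractionalIdeal.coeIdeal_le_one)
  obtain ⟨t, ht⟩ := (FractionalIdeal.mem_one_iff V⁰).mp (hle hmem)
  have hst : s * t = 1 := by
    apply IsFractionRing.injective V K
    rw [map_mul, ht, mul_inv_cancel₀ hs0, map_one]
  exact (IsLocalRing.mem_maximalIdeal s).mp hsM (IsUnit.of_mul_eq_one t hst)

end Valuation

theorem theorem3p5 (V : Type*) [CommRing V] [IsDomain V] [ValuationRing V]
    (K : Type*) [Field K] [Algebra V K] [IsFractionRing V K] :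
    (IsStarOperation (ratliffRushClosure : NonzeroFracIdeal V K → NonzeroFracIdeal V K) ↔
      ∀ P : Ideal V, P.IsPrime → P ≠ ⊥ → ¬ P.IsMaximal → P * P ≠ P) ∧
    (IsStarOperation (ratliffRushClosure : NonzeroFracIdeal V K → NonzeroFracIdeal V K) →
      ∀ I : NonzeroFracIdeal V K, ratliffRushClosure I = vClosure I) := by
  refine ⟨⟨fun hstar => hstar.mul_self_ne_of_not_isMaximal, fun hV => ?_⟩, fun hstar =>
    ratliffRushClosure_eq_vClosure hstar.mul_self_ne_of_not_isMaximal⟩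
  rw [funext (ratliffRushClosure_eq_vClosure (K := K) hV)]
  exact isStarOperation_vClosure
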